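/- Let $L>0$ and let $\mathbb T^2=\mathbb R^2/(\mathbb Z\times L\mathbb Z)$ with coordinates $(x,y)$, its flat metric $g_{\mathrm{con}}$, and the standard orientation. A magnetic function is a smooth function $b:\mathbb T^2\to\mathbb R$; its average is $\langle b\rangle=\frac1L\int_0^1\int_0^L b(x,y)\,dy\,dx$. The flow of $(g_{\mathrm{con}},b)$ on the unit tangent bundle $\mathrm S\mathbb T^2$ is $\Phi^t(q,v)=(\gamma(t),\dot\gamma(t))$, where $\gamma$ is the unit-speed curve with $(\gamma(0),\dot\gamma(0))=(q,v)$ and geodesic curvature $\kappa_\gamma(t)=b(\gamma(t))$. The pair $(g_{\mathrm{con}},b)$ is called Zoll if, up to reparametrisation of time along the orbits, this flow is a free circle action, i.e. if there is a smooth free action of $\mathbb R/\mathbb Z$ on $\mathrm S\mathbb T^2$ whose oriented orbits are those of $\Phi$. Let $J_1$ be the Bessel function of the first kind of order one and let $$\mathcal B=\{2\pi n/\xi \;:\; n\in\mathbb N,\ n\ge 1,\ \xi\in(0,\infty),\ J_1(\xi)=0\}.$$ (1) If $b_{\mathrm{con}}\in\mathcal B$, then there is a family of magnetic functions $b_s:\mathbb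 T^2\to(0,\infty)$, $s\in(-b_{\mathrm{con}}^{-1},b_{\mathrm{con}}^{-1})$, depending smoothly on $s$ (that is, $(s,q)\mapsto b_s(q)$ is smooth), each depending only on the $x$-variable, such that $b_0=b_{\mathrm{con}}$ and, for all $s$, $\langle b_s\rangle=b_{\mathrm{con}}$ and $(g_{\mathrm{con}},b_s)$ is Zoll. Moreover $$\frac{\mathrm d b_s}{\mathrm d s}(0)\ne 0,\qquad \lim_{s\to\pm b_{\mathrm{con}}^{-1}}\max b_s=\infty,$$ where the first condition says that the derivative is not the zero function on $\mathbb T^2$. (2) If $b_{\mathrm{con}}\ge 0$ and $b_{\mathrm{con}}\notin\mathcal B$, then every magnetic function $b$ depending only on $x$, with $\langle b\rangle=b_{\mathrm{con}}$ and $(g_{\mathrm{con}},b)$ Zoll, is the constant $b_{\mathrm{con}}$. If in addition $b_{\mathrm{con}}>0$, then $(g_{\mathrm{con}},b_{\mathrm{con}})$ is Zoll. -/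

import Mathlib

open scoped ContDiff Topology

noncomputable section

namespace MagneticTorus

/-- The Bessel function of the first kind of order one, through its classical integral
representation `J₁(ξ) = (ξ / 2π) ∫₀^{2π} cos (ξ sin θ) cos² θ dθ`. -/
def besselJ1 (ξ : ℝ) : ℝ :=
  ξ / (2 * Real.pi) *
    ∫ θ in (0 : ℝ)..(2 * Real.pi), Real.cos (ξ * Real.sin θ) * Real.cos θ ^ 2

/-- The set `𝓑` of the numbers `2πn/ξ` with `n ≥ 1` an integer and `ξ > 0` a zero of `J₁`. -/
def resonantSet : Set ℝ :=
  {β | ∃ (n : ℕ) (ξ : ℝ), 0 < n ∧ 0 < ξ ∧ besselJ1 ξ = 0 ∧ β = 2 * Real.pi * n / ξ}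

/-- The torus `ℝ² / (ℤ × Lℤ)`, with coordinates `(x, y)`; it carries the flat metric induced by
the Euclidean metric of `ℝ²`. -/
abbrev FlatTorus (L : ℝ) : Type := AddCircle (1 : ℝ) × AddCircle L

/-- The unit tangent bundle of the flat torus. It is trivialised by `∂_x, ∂_y`, and the unit
vector `v_x ∂_x + v_y ∂_y` is the unit complex number `v_x + i v_y`; in particular the rotation
of tangent vectors by `π / 2` is multiplication by `i`. -/
abbrev UnitTangent (L : ℝ) : Type := FlatTorus L × Circle

/-- The covering projection `ℂ = ℝ² → ℝ² / (ℤ × Lℤ)`. -/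
def proj (L : ℝ) (w : ℂ) : FlatTorus L := ((w.re : AddCircle (1 : ℝ)), (w.im : AddCircle L))

/-- The covering projection `(x, y, θ) ↦ ([x], [y], cos θ ∂_x + sin θ ∂_y)` from `ℝ³` onto the
unit tangent bundle. -/
def unitProj (L : ℝ) (p : ℝ × ℝ × ℝ) : UnitTangent L :=
  (((p.1 : AddCircle (1 : ℝ)), (p.2.1 : AddCircle L)), Circle.exp p.2.2)

/-- A magnetic function is a smooth real function on the torus: one whose lift to `ℝ²` is
smooth. -/
def IsMagneticFunction (L : ℝ) (b : FlatTorus L → ℝ) : Prop :=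
  ContDiff ℝ ∞ fun q : ℝ × ℝ => b ((q.1 : AddCircle (1 : ℝ)), (q.2 : AddCircle L))

/-- The function depends only on the variable `x`. -/
def DependsOnlyOnX (L : ℝ) (b : FlatTorus L → ℝ) : Prop :=
  ∀ (x : AddCircle (1 : ℝ)) (y y' : AddCircle L), b (x, y) = b (x, y')

/-- The average of a function over the flat torus, whose area is `1 * L`. -/
def average (L : ℝ) (b : FlatTorus L → ℝ) : ℝ :=
  (∫ x in (0 : ℝ)..1, ∫ y in (0 : ℝ)..L, b ((x : AddCircle (1 : ℝ)), (y : AddCircle L))) / (1 * L)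

/-- `c` is the tangent lift `t ↦ (γ t, γ' t)` of a unit-speed curve `γ` on the flat torus whose
geodesic curvature at time `t` is `b (γ t)`. Here `w` is a lift of `γ` to the plane, so that
the equations are `w' = v`, `|v| = 1` and `v' = b(γ) i v`. -/
def IsLiftedGeodesic (L : ℝ) (b : FlatTorus L → ℝ) (c : ℝ → UnitTangent L) : Prop :=
  ∃ w : ℝ → ℂ,
    (∀ t, (c t).1 = proj L (w t)) ∧
    (∀ t, HasDerivAt w ((c t).2 : ℂ) t) ∧
    ∀ t, HasDerivAt (fun s => ((c s).2 : ℂ)) ((b (c t).1 : ℂ) * (Complex.I * ((c t).2 : ℂ))) t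

/-- `Φ` is the flow `Φ^t(q, v) = (γ(t), γ'(t))` on the unit tangent bundle, where `γ` is the
magnetic geodesic with initial conditions `(q, v)`. -/
def IsMagneticFlow (L : ℝ) (b : FlatTorus L → ℝ) (Φ : ℝ → UnitTangent L → UnitTangent L) : Prop :=
  ∀ z, Φ 0 z = z ∧ IsLiftedGeodesic L b fun t => Φ t z

/-- A smooth free action of the circle group `ℝ / ℤ` on the unit tangent bundle. Smoothness of
`(t, z) ↦ A t z` is smoothness of its lift `ℝ × ℝ³ → ℝ³` to the universal covers. -/
structure IsSmoothFreeCircleAction (L : ℝ)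
    (A : UnitAddCircle → UnitTangent L → UnitTangent L) : Prop where
  zero_act : ∀ z, A 0 z = z
  add_act : ∀ s t z, A (s + t) z = A s (A t z)
  free : ∀ t z, A t z = z → t = 0
  smooth : ∃ G : ℝ × (ℝ × ℝ × ℝ) → ℝ × ℝ × ℝ, ContDiff ℝ ∞ G ∧
    ∀ (t : ℝ) (p : ℝ × ℝ × ℝ), unitProj L (G (t, p)) = A (t : UnitAddCircle) (unitProj L p)

/-- The pair of the flat metric and `b` is Zoll: its flow yields a free circle action, i.e. there
is a smooth free circle action on the unit tangent bundle whose oriented orbits are those of the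
flow. The time along each orbit may be reparametrised (by an increasing bijection `τ` of `ℝ`), so
that magnetic geodesics are not required to have equal lengths. -/
def IsZoll (L : ℝ) (b : FlatTorus L → ℝ) : Prop :=
  ∃ (Φ : ℝ → UnitTangent L → UnitTangent L) (A : UnitAddCircle → UnitTangent L → UnitTangent L),
    IsMagneticFlow L b Φ ∧ IsSmoothFreeCircleAction L A ∧
    ∀ z, ∃ τ : ℝ ≃o ℝ, ∀ t : ℝ, A (t : UnitAddCircle) z = Φ (τ t) z

end MagneticTorus

end

namespace MagneticTorus

/-! In coordinates the flow is x' = cos θ, y' = sin θ, θ' = β(x), and B(x) - sin θ is conserved when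
B' = β. If β > 0, the angle parametrises each orbit. With X = B⁻¹ and m = X' = 1/(β ∘ X), the orbit
of level c is x = X(c + sin θ), dy/dθ = sin θ · m(c + sin θ), so one turn moves y by D(c) = ∫₀^{2π}
sin θ · m(c + sin θ) dθ. If D = 0, rotating the angle along orbits is a free circle action
(`IsClosedProfile.isZoll`).

For m(u) = 1/β + s cos(κu) one finds D(c) = -2πs J₁(κ) sin(κc). A zero κ of J₁ with κβ ∈ 2πℤ
therefore gives the family, and s = 0 gives the constant fields.

Conversely, a Zoll field has no zero (`ne_zero_of_isZoll`), so with nonnegative average it is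
positive. Closed orbits force D(c) ∈ ℚL, so the continuous function D is constant. Its Fourier
coefficient at κ = 2πk/β, where β now denotes the average, is 2πi J₁(κ) times that of m. Off the
resonant set J₁(κ) ≠ 0 for k ≠ 0, hence m is constant. -/

/-! ### Lifting the flow to ℝ³ -/

theorem addCircle_coe_eq_iff {p x y : ℝ} :
    (x : AddCircle p) = (y : AddCircle p) ↔ ∃ n : ℤ, y = x + n * p := by
  rw [QuotientAddGroup.eq, AddSubgroup.mem_zmultiples_iff]
  constructor
  · rintro ⟨n, hn⟩
    exact ⟨n, by rw [zsmul_eq_mul] at hn; linarith⟩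
  · rintro ⟨n, hn⟩
    exact ⟨n, by rw [zsmul_eq_mul]; linarith⟩

theorem unitProj_eq_iff {L : ℝ} {p q : ℝ × ℝ × ℝ} :
    unitProj L p = unitProj L q ↔
      ∃ i j k : ℤ, q = (p.1 + i, p.2.1 + j * L, p.2.2 + k * (2 * Real.pi)) := by
  obtain ⟨x, y, θ⟩ := p
  obtain ⟨x', y', θ'⟩ := q
  simp only [unitProj, Prod.mk.injEq, addCircle_coe_eq_iff, mul_one]
  rw [eq_comm (a := Circle.exp θ), Circle.exp_eq_exp]
  constructor
  · rintro ⟨⟨⟨i, hi⟩, ⟨j, hj⟩⟩, ⟨k, hk⟩⟩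
    exact ⟨i, j, k, hi, hj, hk⟩
  · rintro ⟨i, j, k, hi, hj, hk⟩
    exact ⟨⟨⟨i, hi⟩, ⟨j, hj⟩⟩, ⟨k, hk⟩⟩

theorem unitProj_surjective (L : ℝ) : Function.Surjective (unitProj L) := by
  rintro ⟨⟨x, y⟩, v⟩
  obtain ⟨x, rfl⟩ := QuotientAddGroup.mk_surjective x
  obtain ⟨y, rfl⟩ := QuotientAddGroup.mk_surjective y
  exact ⟨(x, y, Complex.arg v), by simp [unitProj, Circle.exp_arg]⟩

theorem hasDerivAt_exp_I {θ : ℝ → ℝ} {θ' t : ℝ} (h : HasDerivAt θ θ' t) :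
    HasDerivAt (fun s => Complex.exp (θ s * Complex.I))
      (θ' * (Complex.I * Complex.exp (θ t * Complex.I))) t := by
  exact ((h.ofReal_comp).mul_const Complex.I).cexp.congr_deriv (by ring)

/-- The curve with real coordinates `(x, y, θ)` solves the lifted equations of motion. -/
structure IsLiftedSolution (β : ℝ → ℝ) (x y θ : ℝ → ℝ) : Prop where
  hx : ∀ t, HasDerivAt x (Real.cos (θ t)) t
  hy : ∀ t, HasDerivAt y (Real.sin (θ t)) t
  hθ : ∀ t, HasDerivAt θ (β (x t)) t

theorem IsLiftedSolution.isLiftedGeodesic {L : ℝ} {b : FlatTorus L → ℝ} {β : ℝ → ℝ}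
    (hb : ∀ x y : ℝ, b ((x : AddCircle (1 : ℝ)), (y : AddCircle L)) = β x) {x y θ : ℝ → ℝ}
    (h : IsLiftedSolution β x y θ) :
    IsLiftedGeodesic L b fun t => unitProj L (x t, y t, θ t) := by
  refine ⟨fun t => x t + y t * Complex.I, fun t => by simp [proj, unitProj], fun t => ?_,
    fun t => ?_⟩
  · refine ((h.hx t).ofReal_comp.add ((h.hy t).ofReal_comp.mul_const Complex.I)).congr_deriv ?_
    simp [unitProj, Circle.coe_exp, Complex.exp_mul_I]
  · simp only [unitProj, Circle.coe_exp, hb]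
    exact hasDerivAt_exp_I (h.hθ t)

/-- The angle is lifted by integrating the curvature from θ₀. The given planar lift may start over
another representative of the base point, so it is moved by a deck translation. -/
theorem IsLiftedGeodesic.exists_solution {L : ℝ} {b : FlatTorus L → ℝ} {β : ℝ → ℝ}
    (hβ : Continuous β)
    (hb : ∀ x y : ℝ, b ((x : AddCircle (1 : ℝ)), (y : AddCircle L)) = β x)
    {c : ℝ → UnitTangent L} (hc : IsLiftedGeodesic L b c) {x₀ y₀ θ₀ : ℝ}
    (h₀ : c 0 = unitProj L (x₀, y₀, θ₀)) :
    ∃ x y θ : ℝ → ℝ, IsLiftedSolution β x y θ ∧ x 0 = x₀ ∧ y 0 = y₀ ∧ θ 0 = θ₀ ∧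
      ∀ t, c t = unitProj L (x t, y t, θ t) := by
  obtain ⟨w, hw, hw', hv⟩ := hc
  have hbw : ∀ t, b (c t).1 = β (w t).re := fun t => by rw [hw, proj, hb]
  have hwc : Continuous fun t => (w t).re :=
    Complex.continuous_re.comp (continuous_iff_continuousAt.2 fun t => (hw' t).continuousAt)
  have hfc : Continuous fun t => β (w t).re := hβ.comp hwc
  set θ : ℝ → ℝ := fun t => θ₀ + ∫ s in (0 : ℝ)..t, β (w s).re with hθ
  have hθ' : ∀ t, HasDerivAt θ (β (w t).re) t := fun t =>
    (intervalIntegral.integral_hasDerivAt_right (hfc.intervalIntegrable _ _)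
      (hfc.stronglyMeasurableAtFilter _ _) hfc.continuousAt).const_add _
  have hv0 : ((c 0).2 : ℂ) = Complex.exp (θ₀ * Complex.I) := by
    rw [h₀]; simp [unitProj, Circle.coe_exp]
  -- v and exp(iθ) solve the same linear equation with the same initial value, so their quotient is
  -- constant.
  have key : ∀ t, ((c t).2 : ℂ) * Complex.exp ((-θ t : ℝ) * Complex.I) = 1 := by
    have hd : ∀ t, HasDerivAt
        (fun t => ((c t).2 : ℂ) * Complex.exp ((-θ t : ℝ) * Complex.I)) 0 t := fun t => by
      refine ((hv t).mul (hasDerivAt_exp_I (hθ' t).neg)).congr_deriv ?_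
      rw [hbw]
      push_cast
      ring
    intro t
    have := is_const_of_deriv_eq_zero (fun t => (hd t).differentiableAt)
      (fun t => (hd t).deriv) t 0
    rw [this, hv0, ← Complex.exp_add]
    simp [hθ]
  have hvt : ∀ t, (c t).2 = Circle.exp (θ t) := fun t => by
    ext
    rw [Circle.coe_exp]
    have := key t
    push_cast at this
    rw [neg_mul, Complex.exp_neg] at this
    field_simp at this
    exact this
  have hp : unitProj L ((w 0).re, (w 0).im, θ₀) = unitProj L (x₀, y₀, θ₀) := by
    rw [← h₀]
    refine Prod.ext (hw 0).symm ?_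
    rw [hvt]
    simp [unitProj, hθ]
  obtain ⟨⟨i, hi⟩, ⟨j, hj⟩⟩ : (∃ i : ℤ, x₀ = (w 0).re + i) ∧ ∃ j : ℤ, y₀ = (w 0).im + j * L := by
    obtain ⟨i, j, k, h⟩ := unitProj_eq_iff.1 hp
    simp only [Prod.mk.injEq] at h
    exact ⟨⟨i, h.1⟩, ⟨j, h.2.1⟩⟩
  have hper : ∀ x : ℝ, β (x + i) = β x := fun x => by
    rw [← hb x 0, ← hb (x + i) 0]
    congr 2
    exact (addCircle_coe_eq_iff.2 ⟨i, by simp⟩).symm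
  refine ⟨fun t => (w t).re + i, fun t => (w t).im + j * L, θ, ⟨fun t => ?_, fun t => ?_,
    fun t => ?_⟩, hi.symm, hj.symm, by simp [hθ], fun t => ?_⟩
  · have h := (Complex.reCLM.hasFDerivAt.comp_hasDerivAt t (hw' t)).add_const (i : ℝ)
    rw [hvt, Circle.coe_exp, Complex.reCLM_apply, Complex.exp_ofReal_mul_I_re] at h
    exact h
  · have h := (Complex.imCLM.hasFDerivAt.comp_hasDerivAt t (hw' t)).add_const (j * L : ℝ)
    rw [hvt, Circle.coe_exp, Complex.imCLM_apply, Complex.exp_ofReal_mul_I_im] at h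
    exact h
  · rw [hper]
    exact hθ' t
  · have : unitProj L ((w t).re + i, (w t).im + j * L, θ t) =
        unitProj L ((w t).re, (w t).im, θ t) :=
      (unitProj_eq_iff.2 ⟨i, j, 0, by simp⟩).symm
    rw [this]
    exact Prod.ext (hw t) (hvt t)

/-! ### Closed profiles and their circle action -/

theorem surjective_of_hasDerivAt_ge {F f : ℝ → ℝ} {δ : ℝ} (hδ : 0 < δ)
    (hF : ∀ t, HasDerivAt F (f t) t) (hf : ∀ t, δ ≤ f t) : Function.Surjective F := by
  have hgrow : Monotone fun t => F t - δ * t :=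
    monotone_of_hasDerivAt_nonneg (f' := fun t => f t - δ)
      (fun t => ((hF t).sub ((hasDerivAt_id t).const_mul δ)).congr_deriv (by simp))
      fun t => sub_nonneg.2 (hf t)
  have hlin : ∀ l : Filter ℝ, Filter.Tendsto (fun t : ℝ => t) l l := fun l => Filter.tendsto_id
  refine Continuous.surjective (continuous_iff_continuousAt.2 fun t => (hF t).continuousAt) ?_ ?_
  · refine Filter.tendsto_atTop_mono' _ ?_
      (Filter.tendsto_atTop_add_const_left _ (F 0) ((hlin _).const_mul_atTop hδ))
    filter_upwards [Filter.eventually_ge_atTop 0] with t ht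
    have := hgrow ht
    simp only at this
    linarith
  · refine Filter.tendsto_atBot_mono' _ ?_
      (Filter.tendsto_atBot_add_const_left _ (F 0) ((hlin _).const_mul_atBot hδ))
    filter_upwards [Filter.eventually_le_atBot 0] with t ht
    have := hgrow ht
    simp only at this
    linarith

/-- The data integrating the flow of a positive function `1 / (m ∘ B)` of `x`: the increasing
primitive `B`, its inverse `X` with derivative `m`, and, for each value `c` of the integral of
motion `B x - sin θ`, a `2π`-periodic displacement `H c` in the `y` direction as a function of the
angle. -/
structure IsClosedProfile (β : ℝ) (X m B : ℝ → ℝ) (H : ℝ → ℝ → ℝ) : Prop where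
  hasDerivAt_X : ∀ u, HasDerivAt X (m u) u
  contDiff_X : ContDiff ℝ ∞ X
  contDiff_B : ContDiff ℝ ∞ B
  continuous_m : Continuous m
  exists_lower : ∃ δ > 0, ∀ u, δ ≤ m u
  B_X : ∀ u, B (X u) = u
  X_B : ∀ x, X (B x) = x
  X_add : ∀ u, X (u + β) = X u + 1
  contDiff_H : ContDiff ℝ ∞ fun q : ℝ × ℝ => H q.1 q.2
  hasDerivAt_H : ∀ c θ, HasDerivAt (H c) (Real.sin θ * m (c + Real.sin θ)) θ
  H_periodic : ∀ c θ, H c (θ + 2 * Real.pi) = H c θ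
  H_add : ∀ c θ, H (c + β) θ = H c θ

/-- The lifted circle action: it advances the angle by `2πt` along the orbit. -/
noncomputable def liftAct (X B : ℝ → ℝ) (H : ℝ → ℝ → ℝ) (q : ℝ × (ℝ × ℝ × ℝ)) : ℝ × ℝ × ℝ :=
  (X (B q.2.1 - Real.sin q.2.2.2 + Real.sin (q.2.2.2 + 2 * Real.pi * q.1)),
    q.2.2.1 + (H (B q.2.1 - Real.sin q.2.2.2) (q.2.2.2 + 2 * Real.pi * q.1) -
      H (B q.2.1 - Real.sin q.2.2.2) q.2.2.2),
    q.2.2.2 + 2 * Real.pi * q.1)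

namespace IsClosedProfile

variable {β : ℝ} {X m B : ℝ → ℝ} {H : ℝ → ℝ → ℝ}

theorem X_add_int (h : IsClosedProfile β X m B H) (u : ℝ) (i : ℤ) : X (u + i * β) = X u + i := by
  induction i with
  | zero => simp
  | succ i ih =>
    push_cast at ih ⊢
    rw [show u + (i + 1) * β = (u + i * β) + β by ring, h.X_add, ih]
    ring
  | pred i ih =>
    push_cast at ih ⊢
    have := h.X_add (u + (-i - 1) * β)
    rw [show u + (-i - 1) * β + β = u + -i * β by ring, ih] at this
    linarith

theorem B_add_int (h : IsClosedProfile β X m B H) (x : ℝ) (i : ℤ) : B (x + i) = B x + i * β := by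
  rw [← h.B_X (B x + i * β), h.X_add_int, h.X_B]

theorem H_add_int (h : IsClosedProfile β X m B H) (c θ : ℝ) (i : ℤ) :
    H (c + i * β) θ = H c θ :=
  (show Function.Periodic (fun c => H c θ) β from fun c => h.H_add c θ).int_mul i c

theorem H_periodic_int (h : IsClosedProfile β X m B H) (c θ : ℝ) (k : ℤ) :
    H c (θ + k * (2 * Real.pi)) = H c θ :=
  (show Function.Periodic (H c) (2 * Real.pi) from h.H_periodic c).int_mul k θ

theorem contDiff_liftAct (h : IsClosedProfile β X m B H) : ContDiff ℝ ∞ (liftAct X B H) := by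
  have hX := h.contDiff_X
  have hB := h.contDiff_B
  have hc : ContDiff ℝ ∞ fun q : ℝ × (ℝ × ℝ × ℝ) => B q.2.1 - Real.sin q.2.2.2 :=
    (hB.comp (by fun_prop)).sub (Real.contDiff_sin.comp (by fun_prop))
  have hφ : ContDiff ℝ ∞ fun q : ℝ × (ℝ × ℝ × ℝ) => q.2.2.2 + 2 * Real.pi * q.1 := by fun_prop
  exact (hX.comp (hc.add (Real.contDiff_sin.comp hφ))).prodMk
    ((ContDiff.add (by fun_prop) ((h.contDiff_H.comp (hc.prodMk hφ)).sub
      (h.contDiff_H.comp (hc.prodMk (by fun_prop))))).prodMk hφ)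

theorem liftAct_zero (h : IsClosedProfile β X m B H) (p : ℝ × ℝ × ℝ) :
    liftAct X B H (0, p) = p := by
  simp [liftAct, h.X_B]

/-- `liftAct` preserves c = B x - sin θ, so the increments of `H c` telescope. -/
theorem liftAct_add (h : IsClosedProfile β X m B H) (s t : ℝ) (p : ℝ × ℝ × ℝ) :
    liftAct X B H (s + t, p) = liftAct X B H (s, liftAct X B H (t, p)) := by
  have hφ : p.2.2 + 2 * Real.pi * (s + t) = p.2.2 + 2 * Real.pi * t + 2 * Real.pi * s := by ring
  simp only [liftAct, h.B_X, add_sub_cancel_right, hφ]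
  refine Prod.ext rfl (Prod.ext ?_ rfl)
  dsimp only
  ring

/-- Descent to the quotient. Moving x by i moves c by iβ, which `X` and `H` respect; an integer time
adds full turns, which leave y unchanged because `H c` is 2π-periodic. -/
theorem unitProj_liftAct_congr (h : IsClosedProfile β X m B H) {L t t' : ℝ} {p p' : ℝ × ℝ × ℝ}
    (ht : (t : UnitAddCircle) = t') (hp : unitProj L p = unitProj L p') :
    unitProj L (liftAct X B H (t, p)) = unitProj L (liftAct X B H (t', p')) := by
  obtain ⟨n, rfl⟩ := addCircle_coe_eq_iff.1 ht
  obtain ⟨i, j, k, rfl⟩ := unitProj_eq_iff.1 hp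
  obtain ⟨x, y, θ⟩ := p
  have hφ : θ + k * (2 * Real.pi) + 2 * Real.pi * (t + n * 1) =
      θ + 2 * Real.pi * t + ((k + n : ℤ) : ℝ) * (2 * Real.pi) := by push_cast; ring
  have hc : B x + i * β - Real.sin θ = B x - Real.sin θ + i * β := by ring
  refine unitProj_eq_iff.2 ⟨i, j, k + n, ?_⟩
  simp only [liftAct, hφ, Real.sin_add_int_mul_two_pi, h.B_add_int, hc, h.H_add_int,
    h.H_periodic_int]
  refine Prod.ext ?_ (Prod.ext ?_ rfl)
  · dsimp only
    rw [add_right_comm, h.X_add_int]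
  · dsimp only
    ring

/-- The elapsed time, as a function of the action time, along the orbit with integral of motion
`c` that starts at the angle `θ`. -/
theorem exists_time (h : IsClosedProfile β X m B H) (c θ : ℝ) :
    ∃ T : ℝ ≃o ℝ, T 0 = 0 ∧
      ∀ t, HasDerivAt T (2 * Real.pi * m (c + Real.sin (θ + 2 * Real.pi * t))) t := by
  obtain ⟨δ, hδ, hm⟩ := h.exists_lower
  set f : ℝ → ℝ := fun t => 2 * Real.pi * m (c + Real.sin (θ + 2 * Real.pi * t)) with hf
  have hfc : Continuous f := by
    have := h.continuous_m
    fun_prop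
  have hfδ : ∀ t, 2 * Real.pi * δ ≤ f t := fun t =>
    mul_le_mul_of_nonneg_left (hm _) Real.two_pi_pos.le
  have hpos : 0 < 2 * Real.pi * δ := by positivity
  set F : ℝ → ℝ := fun t => ∫ s in (0 : ℝ)..t, f s with hF
  have hF' : ∀ t, HasDerivAt F (f t) t := fun t =>
    intervalIntegral.integral_hasDerivAt_right (hfc.intervalIntegrable _ _)
      (hfc.stronglyMeasurableAtFilter _ _) hfc.continuousAt
  have hmono : StrictMono F := strictMono_of_hasDerivAt_pos hF' fun t => hpos.trans_le (hfδ t)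
  exact ⟨hmono.orderIsoOfSurjective F (surjective_of_hasDerivAt_ge hpos hF' hfδ),
    intervalIntegral.integral_same, hF'⟩

/-- In action time the angle has speed 2π and physical time has speed 2πm, so in physical time θ' =
1/m; this factor cancels the m in the θ-derivatives of x and y. -/
theorem isLiftedSolution (h : IsClosedProfile β X m B H) (p : ℝ × ℝ × ℝ) {T : ℝ ≃o ℝ}
    (hT : ∀ t, HasDerivAt T
      (2 * Real.pi * m (B p.1 - Real.sin p.2.2 + Real.sin (p.2.2 + 2 * Real.pi * t))) t) :
    IsLiftedSolution (fun x => (m (B x))⁻¹)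
      (fun t => (liftAct X B H (T.symm t, p)).1) (fun t => (liftAct X B H (T.symm t, p)).2.1)
      (fun t => (liftAct X B H (T.symm t, p)).2.2) := by
  obtain ⟨x, y, θ⟩ := p
  obtain ⟨δ, hδ, hm⟩ := h.exists_lower
  have hm0 : ∀ u, m u ≠ 0 := fun u => (hδ.trans_le (hm u)).ne'
  have hpi := Real.pi_ne_zero
  dsimp only at hT
  set c := B x - Real.sin θ with hc
  have hS : ∀ t, HasDerivAt T.symm
      (2 * Real.pi * m (c + Real.sin (θ + 2 * Real.pi * T.symm t)))⁻¹ t := fun t =>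
    HasDerivAt.of_local_left_inverse T.symm.continuous.continuousAt (hT _)
      (mul_ne_zero (by positivity) (hm0 _)) (Filter.Eventually.of_forall T.apply_symm_apply)
  have hφ : ∀ t, HasDerivAt (fun t => θ + 2 * Real.pi * T.symm t)
      (m (c + Real.sin (θ + 2 * Real.pi * T.symm t)))⁻¹ t := fun t =>
    (((hS t).const_mul (2 * Real.pi)).const_add θ).congr_deriv (by
      have := hm0 (c + Real.sin (θ + 2 * Real.pi * T.symm t))
      field_simp)
  refine ⟨fun t => ?_, fun t => ?_, fun t => ?_⟩
  · refine ((h.hasDerivAt_X _).comp t ((hφ t).sin.const_add c)).congr_deriv ?_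
    have := hm0 (c + Real.sin (θ + 2 * Real.pi * T.symm t))
    simp only [liftAct]
    field_simp
  · refine ((((h.hasDerivAt_H c _).comp t (hφ t)).sub_const (H c θ)).const_add y).congr_deriv ?_
    have := hm0 (c + Real.sin (θ + 2 * Real.pi * T.symm t))
    simp only [liftAct]
    field_simp
  · simpa only [liftAct, h.B_X] using hφ t

/-- The flow and the action come from one curve in ℝ³ over each point, traversed in physical time
and in action time. -/
theorem isZoll (h : IsClosedProfile β X m B H) {L : ℝ} {b : FlatTorus L → ℝ}
    (hb : ∀ x y : ℝ, b ((x : AddCircle (1 : ℝ)), (y : AddCircle L)) = (m (B x))⁻¹) :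
    IsZoll L b := by
  choose lift hlift using unitProj_surjective L
  have hrep : ∀ a : UnitAddCircle, ∃ t : ℝ, (t : UnitAddCircle) = a :=
    QuotientAddGroup.mk_surjective
  choose rep hrep using hrep
  choose T hT0 hT using fun z => h.exists_time (B (lift z).1 - Real.sin (lift z).2.2) (lift z).2.2
  set A : UnitAddCircle → UnitTangent L → UnitTangent L := fun a z =>
    unitProj L (liftAct X B H (rep a, lift z)) with hA
  have hA' : ∀ (t : ℝ) (p : ℝ × ℝ × ℝ),
      A (t : UnitAddCircle) (unitProj L p) = unitProj L (liftAct X B H (t, p)) := fun t p =>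
    h.unitProj_liftAct_congr (hrep _) (hlift _)
  refine ⟨fun t z => unitProj L (liftAct X B H ((T z).symm t, lift z)), A, fun z => ⟨?_, ?_⟩,
    ⟨fun z => ?_, fun s t z => ?_, fun t z ht => ?_, liftAct X B H, h.contDiff_liftAct,
      fun t p => (hA' t p).symm⟩, fun z => ⟨T z, fun t => ?_⟩⟩
  · have : (T z).symm 0 = 0 := by rw [OrderIso.symm_apply_eq, hT0]
    simp only [this, h.liftAct_zero, hlift]
  · exact (h.isLiftedSolution (lift z) (hT z)).isLiftedGeodesic hb
  · rw [← hlift z, ← QuotientAddGroup.mk_zero]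
    exact (hA' 0 _).trans (by rw [h.liftAct_zero])
  · obtain ⟨s, rfl⟩ := QuotientAddGroup.mk_surjective s
    obtain ⟨t, rfl⟩ := QuotientAddGroup.mk_surjective t
    obtain ⟨p, rfl⟩ := unitProj_surjective L z
    refine (hA' (s + t) p).trans ?_
    rw [h.liftAct_add, ← hA', ← hA']
  · rw [← hlift z, ← hrep t, hA'] at ht
    obtain ⟨i, j, k, hk⟩ := unitProj_eq_iff.1 ht.symm
    -- Freeness is read off the angle, which time t advances by exactly 2πt.
    have h3 : (lift z).2.2 + 2 * Real.pi * rep t = (lift z).2.2 + k * (2 * Real.pi) :=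
      congrArg (fun q => q.2.2) hk
    have h4 : rep t = k := mul_left_cancel₀ Real.two_pi_pos.ne' (by linarith)
    rw [← hrep t, h4, ← QuotientAddGroup.mk_zero]
    exact (addCircle_coe_eq_iff.2 ⟨k, by simp⟩).symm
  · dsimp only
    rw [(T z).symm_apply_apply, ← hA', hlift]

end IsClosedProfile

/-! ### Bessel integrals and the cosine family -/

/-- The integrand is odd under θ ↦ 2π - θ. -/
theorem integral_sin_mul_cos (κ : ℝ) :
    ∫ θ in (0 : ℝ)..(2 * Real.pi), Real.sin θ * Real.cos (κ * Real.sin θ) = 0 := by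
  have h := intervalIntegral.integral_comp_sub_left (a := 0) (b := 2 * Real.pi)
    (fun θ => Real.sin θ * Real.cos (κ * Real.sin θ)) (2 * Real.pi)
  simp only [Real.sin_two_pi_sub, mul_neg, Real.cos_neg, neg_mul, intervalIntegral.integral_neg,
    sub_self, sub_zero] at h
  linarith

/-- Integration by parts, with boundary term cos θ · sin(κ sin θ), which vanishes at both ends. -/
theorem integral_sin_mul_sin (κ : ℝ) :
    ∫ θ in (0 : ℝ)..(2 * Real.pi), Real.sin θ * Real.sin (κ * Real.sin θ) =
      2 * Real.pi * besselJ1 κ := by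
  have hd : ∀ θ ∈ Set.uIcc 0 (2 * Real.pi),
      HasDerivAt (fun θ => -(Real.cos θ * Real.sin (κ * Real.sin θ)))
        (Real.sin θ * Real.sin (κ * Real.sin θ) -
          κ * (Real.cos (κ * Real.sin θ) * Real.cos θ ^ 2)) θ := fun θ _ =>
    ((Real.hasDerivAt_cos θ).mul ((Real.hasDerivAt_sin θ).const_mul κ).sin).neg.congr_deriv
      (by ring)
  have h := intervalIntegral.integral_eq_sub_of_hasDerivAt hd
    (Continuous.intervalIntegrable (by fun_prop) _ _)
  rw [intervalIntegral.integral_sub (Continuous.intervalIntegrable (by fun_prop) _ _)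
    (Continuous.intervalIntegrable (by fun_prop) _ _), intervalIntegral.integral_const_mul] at h
  simp only [Real.sin_two_pi, Real.sin_zero, mul_zero, neg_zero, sub_zero] at h
  have hpi := Real.pi_ne_zero
  rw [besselJ1, sub_eq_zero.1 h]
  field_simp

theorem contDiff_primitive {f : ℝ → ℝ} (hf : ContDiff ℝ ∞ f) :
    ContDiff ℝ ∞ fun θ => ∫ t in (0 : ℝ)..θ, f t := by
  have hd : ∀ θ, HasDerivAt (fun θ => ∫ t in (0 : ℝ)..θ, f t) (f θ) θ := fun θ =>
    intervalIntegral.integral_hasDerivAt_right (hf.continuous.intervalIntegrable _ _)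
      (hf.continuous.stronglyMeasurableAtFilter _ _) hf.continuous.continuousAt
  refine contDiff_infty_iff_deriv.2 ⟨fun θ => (hd θ).differentiableAt, ?_⟩
  rwa [show deriv (fun θ => ∫ t in (0 : ℝ)..θ, f t) = f from funext fun θ => (hd θ).deriv]

/-- The inverse of the primitive of the magnetic function with parameters `β, κ, s`. -/
noncomputable def cosX (β κ s u : ℝ) : ℝ := u / β + s * (Real.sin (κ * u) / κ)

/-- The derivative of `cosX` with respect to its last variable. -/
noncomputable def cosM (β κ s u : ℝ) : ℝ := 1 / β + s * Real.cos (κ * u)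

/-- The inverse of `cosX β κ s`. -/
noncomputable def cosB (β κ s : ℝ) : ℝ → ℝ := Function.invFun (cosX β κ s)

/-- The magnetic function with parameters `β, κ, s`. -/
noncomputable def cosField (L β κ s : ℝ) (p : FlatTorus L) : ℝ :=
  (cosM β κ s (cosB β κ s (Quotient.out p.1 : ℝ)))⁻¹

/-- The displacement in the `y` direction as a function of the integral of motion `c` and the
angle `θ`, for the magnetic function with parameters `β, κ, s`. -/
noncomputable def cosH (β κ s c θ : ℝ) : ℝ :=
  -Real.cos θ / β +
    s * (Real.cos (κ * c) * (∫ t in (0 : ℝ)..θ, Real.sin t * Real.cos (κ * Real.sin t)) -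
      Real.sin (κ * c) * ∫ t in (0 : ℝ)..θ, Real.sin t * Real.sin (κ * Real.sin t))

variable {β κ s : ℝ}

theorem hasDerivAt_cosX (hκ : κ ≠ 0) (s u : ℝ) :
    HasDerivAt (cosX β κ s) (cosM β κ s u) u := by
  refine (((hasDerivAt_id u).div_const β).add
    ((((hasDerivAt_id u).const_mul κ).sin.div_const κ).const_mul s)).congr_deriv ?_
  simp only [cosM, id]
  field_simp

theorem cosM_ge (u : ℝ) : β⁻¹ - |s| ≤ cosM β κ s u := by
  have h : |s * Real.cos (κ * u)| ≤ |s| := by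
    rw [abs_mul]
    exact mul_le_of_le_one_right (abs_nonneg _) (Real.abs_cos_le_one _)
  have := neg_le_of_abs_le h
  rw [cosM, one_div]
  linarith

theorem cosM_pos (hs : |s| < β⁻¹) (u : ℝ) : 0 < cosM β κ s u :=
  (sub_pos.2 hs).trans_le (cosM_ge u)

theorem strictMono_cosX (hκ : κ ≠ 0) (hs : |s| < β⁻¹) : StrictMono (cosX β κ s) :=
  strictMono_of_hasDerivAt_pos (hasDerivAt_cosX hκ s) (cosM_pos hs)

theorem cosB_cosX (hκ : κ ≠ 0) (hs : |s| < β⁻¹) (u : ℝ) : cosB β κ s (cosX β κ s u) = u :=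
  Function.leftInverse_invFun (strictMono_cosX hκ hs).injective u

theorem cosX_cosB (hκ : κ ≠ 0) (hs : |s| < β⁻¹) (x : ℝ) : cosX β κ s (cosB β κ s x) = x :=
  Function.rightInverse_invFun
    (surjective_of_hasDerivAt_ge (sub_pos.2 hs) (hasDerivAt_cosX hκ s) cosM_ge) x

theorem contDiff_cosX (β κ : ℝ) : ContDiff ℝ ∞ fun q : ℝ × ℝ => cosX β κ q.1 q.2 := by
  unfold cosX
  fun_prop

/-- Smoothness jointly in the parameter: the inverse function theorem is applied to (s, u) ↦ (s,
`cosX β κ s u`), whose derivative is triangular with diagonal 1, `cosM β κ s u`. -/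
theorem contDiffAt_cosB (hκ : κ ≠ 0) (hs : |s| < β⁻¹) (x : ℝ) :
    ContDiffAt ℝ ∞ (fun q : ℝ × ℝ => cosB β κ q.1 q.2) (s, x) := by
  set u := cosB β κ s x with hu
  set F : ℝ × ℝ → ℝ × ℝ := fun q => (q.1, cosX β κ q.1 q.2) with hF
  have hFs : ContDiffAt ℝ ∞ F (s, u) := (contDiff_fst.prodMk (contDiff_cosX β κ)).contDiffAt
  have hFu : F (s, u) = (s, x) := by simp [hF, hu, cosX_cosB hκ hs]
  have hD := ((contDiff_cosX β κ).differentiable (by simp) (s, u)).hasFDerivAt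
  set D := fderiv ℝ (fun q : ℝ × ℝ => cosX β κ q.1 q.2) (s, u) with hDdef
  have hD1 : D (0, 1) = cosM β κ s u := by
    have h1 : HasDerivAt (fun v : ℝ => (s, v)) ((0 : ℝ), (1 : ℝ)) u :=
      (hasDerivAt_const u s).prodMk (hasDerivAt_id u)
    exact (hD.comp_hasDerivAt u h1).unique (hasDerivAt_cosX hκ s u)
  set E : (ℝ × ℝ) ≃L[ℝ] (ℝ × ℝ) :=
    ContinuousLinearEquiv.skewProd (ContinuousLinearEquiv.refl ℝ ℝ)
      (ContinuousLinearEquiv.unitsEquivAut ℝ (Units.mk0 _ (cosM_pos (κ := κ) hs u).ne'))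
      (D.comp (ContinuousLinearMap.inl ℝ ℝ ℝ)) with hE
  have hFD : HasFDerivAt F (E : (ℝ × ℝ) →L[ℝ] (ℝ × ℝ)) (s, u) := by
    have h : (E : (ℝ × ℝ) →L[ℝ] (ℝ × ℝ)) = (ContinuousLinearMap.fst ℝ ℝ ℝ).prod D := by
      ext <;> simp [hE, hD1, show D (0, 0) = 0 from map_zero D]
    rw [h]
    exact hasFDerivAt_fst.prodMk hD
  have hg := hFs.to_localInverse hFD (by simp)
  have hgF := hFs.localInverse_apply_image hFD (by simp)
  have hright := (hFs.hasStrictFDerivAt' hFD (by simp)).eventually_right_inverse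
  rw [hFu] at hg hgF hright
  set g := hFs.localInverse hFD (by simp) with hgdef
  -- For nearby parameters `cosX` is still injective, which identifies the local inverse with
  -- `cosB`.
  have hmem : ∀ᶠ q in 𝓝 (s, x), |q.1| < β⁻¹ :=
    (continuous_fst.abs.tendsto (s, x)).eventually_lt_const hs
  refine (hg.snd).congr_of_eventuallyEq ?_
  filter_upwards [hright, hmem] with q hq hqs
  have hq' : F (g q) = q := hq
  have h1 : (g q).1 = q.1 := (Prod.ext_iff.1 hq').1
  have h2 : cosX β κ (g q).1 (g q).2 = q.2 := (Prod.ext_iff.1 hq').2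
  rw [← h2, h1, cosB_cosX hκ hqs]

theorem contDiff_cosB (hκ : κ ≠ 0) (hs : |s| < β⁻¹) : ContDiff ℝ ∞ (cosB β κ s) :=
  contDiff_iff_contDiffAt.2 fun x =>
    (contDiffAt_cosB hκ hs x).comp x (f := fun x => (s, x)) (by fun_prop)

theorem hasDerivAt_cosH (β κ s c θ : ℝ) :
    HasDerivAt (cosH β κ s c) (Real.sin θ * cosM β κ s (c + Real.sin θ)) θ := by
  have h1 : Continuous fun t => Real.sin t * Real.cos (κ * Real.sin t) := by fun_prop
  have h2 : Continuous fun t => Real.sin t * Real.sin (κ * Real.sin t) := by fun_prop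
  refine (((Real.hasDerivAt_cos θ).neg.div_const β).add ((HasDerivAt.sub
    ((intervalIntegral.integral_hasDerivAt_right (h1.intervalIntegrable 0 θ)
      (h1.stronglyMeasurableAtFilter _ _) h1.continuousAt).const_mul (Real.cos (κ * c)))
    ((intervalIntegral.integral_hasDerivAt_right (h2.intervalIntegrable 0 θ)
      (h2.stronglyMeasurableAtFilter _ _) h2.continuousAt).const_mul (Real.sin (κ * c)))).const_mul
      s)).congr_deriv ?_
  rw [cosM, mul_add κ, Real.cos_add]
  ring

/-- One turn displaces y by -2πs J₁(κ) sin(κc). Asking only that s J₁(κ) = 0 covers both the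
resonant family and, with s = 0, every constant field. -/
theorem isClosedProfile_cos {n : ℕ} (hβ : 0 < β) (hκ : κ ≠ 0) (hn : κ * β = n * (2 * Real.pi))
    (hs : |s| < β⁻¹) (hJ : s * besselJ1 κ = 0) :
    IsClosedProfile β (cosX β κ s) (cosM β κ s) (cosB β κ s) (cosH β κ s) where
  hasDerivAt_X := hasDerivAt_cosX hκ s
  contDiff_X := (contDiff_cosX β κ).comp (contDiff_prodMk_right s)
  contDiff_B := contDiff_cosB hκ hs
  continuous_m := by unfold cosM; fun_prop
  exists_lower := ⟨β⁻¹ - |s|, sub_pos.2 hs, cosM_ge⟩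
  B_X := cosB_cosX hκ hs
  X_B := cosX_cosB hκ hs
  X_add u := by
    rw [cosX, mul_add, hn, Real.sin_add_nat_mul_two_pi, cosX]
    field_simp
    ring
  contDiff_H := by
    have h1 := contDiff_primitive (f := fun t => Real.sin t * Real.cos (κ * Real.sin t))
      (by fun_prop)
    have h2 := contDiff_primitive (f := fun t => Real.sin t * Real.sin (κ * Real.sin t))
      (by fun_prop)
    have h1' := h1.comp (contDiff_snd (E := ℝ) (F := ℝ))
    have h2' := h2.comp (contDiff_snd (E := ℝ) (F := ℝ))
    exact ContDiff.add (by fun_prop) (contDiff_const.mul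
      ((ContDiff.mul (by fun_prop) h1').sub (ContDiff.mul (by fun_prop) h2')))
  hasDerivAt_H := hasDerivAt_cosH β κ s
  H_periodic c θ := by
    have h1 : Function.Periodic (fun t => Real.sin t * Real.cos (κ * Real.sin t))
        (2 * Real.pi) := fun t => by simp only [Real.sin_add_two_pi]
    have h2 : Function.Periodic (fun t => Real.sin t * Real.sin (κ * Real.sin t))
        (2 * Real.pi) := fun t => by simp only [Real.sin_add_two_pi]
    have c1 : Continuous fun t => Real.sin t * Real.cos (κ * Real.sin t) := by fun_prop
    have c2 : Continuous fun t => Real.sin t * Real.sin (κ * Real.sin t) := by fun_prop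
    rw [cosH, cosH, h1.intervalIntegral_add_eq_add 0 θ fun _ _ => c1.intervalIntegrable _ _,
      h2.intervalIntegral_add_eq_add 0 θ fun _ _ => c2.intervalIntegrable _ _, zero_add,
      integral_sin_mul_cos, integral_sin_mul_sin, Real.cos_add_two_pi]
    linear_combination (-Real.sin (κ * c) * (2 * Real.pi)) * hJ
  H_add c θ := by
    rw [cosH, cosH, mul_add, hn, Real.cos_add_nat_mul_two_pi, Real.sin_add_nat_mul_two_pi]

/-- The representative picked by `Quotient.out` is immaterial: an integer shift of x changes the
cosine's argument by a multiple of 2π. -/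
theorem cosField_coe {n : ℕ} (hn : κ * β = n * (2 * Real.pi))
    (h : IsClosedProfile β (cosX β κ s) (cosM β κ s) (cosB β κ s) (cosH β κ s)) (L x y : ℝ) :
    cosField L β κ s ((x : AddCircle (1 : ℝ)), (y : AddCircle L)) =
      (cosM β κ s (cosB β κ s x))⁻¹ := by
  obtain ⟨i, hi⟩ := addCircle_coe_eq_iff.1
    (QuotientAddGroup.out_eq' (x : AddCircle (1 : ℝ))).symm
  rw [cosField]
  dsimp only
  rw [hi, mul_one, h.B_add_int, cosM, mul_add,
    show κ * (i * β) = ((i * n : ℤ) : ℝ) * (2 * Real.pi) by push_cast; linear_combination i * hn,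
    Real.cos_add_int_mul_two_pi, ← cosM]

theorem cosField_dependsOnlyOnX (L β κ s : ℝ) : DependsOnlyOnX L (cosField L β κ s) :=
  fun _ _ _ => rfl

theorem cosField_pos (hs : |s| < β⁻¹) (L : ℝ) (p : FlatTorus L) : 0 < cosField L β κ s p :=
  inv_pos.2 (cosM_pos hs _)

theorem cosField_le (hs : |s| < β⁻¹) (L : ℝ) (p : FlatTorus L) :
    cosField L β κ s p ≤ (β⁻¹ - |s|)⁻¹ :=
  inv_anti₀ (sub_pos.2 hs) (cosM_ge _)

/-- The field is the derivative of `cosB`, which grows by β over a period. -/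
theorem average_cosField {n : ℕ} (hn : κ * β = n * (2 * Real.pi)) {L : ℝ} (hL : L ≠ 0)
    (hκ : κ ≠ 0) (hs : |s| < β⁻¹)
    (h : IsClosedProfile β (cosX β κ s) (cosM β κ s) (cosB β κ s) (cosH β κ s)) :
    average L (cosField L β κ s) = β := by
  have hB : ∀ x ∈ Set.uIcc (0 : ℝ) 1,
      HasDerivAt (cosB β κ s) (cosM β κ s (cosB β κ s x))⁻¹ x := fun x _ =>
    HasDerivAt.of_local_left_inverse h.contDiff_B.continuous.continuousAt (hasDerivAt_cosX hκ s _)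
      (cosM_pos hs _).ne' (Filter.Eventually.of_forall h.X_B)
  have hc : Continuous fun x => (cosM β κ s (cosB β κ s x))⁻¹ :=
    (h.continuous_m.comp h.contDiff_B.continuous).inv₀ fun x => (cosM_pos hs _).ne'
  have h1 := h.B_add_int 0 1
  simp only [Int.cast_one, one_mul, zero_add] at h1
  simp only [average, cosField_coe hn h, intervalIntegral.integral_const, sub_zero,
    smul_eq_mul, intervalIntegral.integral_const_mul]
  rw [intervalIntegral.integral_eq_sub_of_hasDerivAt hB (hc.intervalIntegrable _ _), h1]
  field_simp
  ring

theorem contDiffOn_cosField {n : ℕ} (hκ : κ ≠ 0)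
    (hn : κ * β = n * (2 * Real.pi))
    (h : ∀ s, |s| < β⁻¹ →
      IsClosedProfile β (cosX β κ s) (cosM β κ s) (cosB β κ s) (cosH β κ s)) (L : ℝ) :
    ContDiffOn ℝ ∞ (fun q : ℝ × ℝ × ℝ =>
      cosField L β κ q.1 ((q.2.1 : AddCircle (1 : ℝ)), (q.2.2 : AddCircle L)))
      (Set.Ioo (-β⁻¹) β⁻¹ ×ˢ Set.univ) := by
  have hM : ContDiff ℝ ∞ fun q : ℝ × ℝ => cosM β κ q.1 q.2 := by
    unfold cosM
    fun_prop
  have key : ContDiffOn ℝ ∞ (fun q : ℝ × ℝ × ℝ => (cosM β κ q.1 (cosB β κ q.1 q.2.1))⁻¹)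
      (Set.Ioo (-β⁻¹) β⁻¹ ×ˢ Set.univ) := by
    rintro ⟨s, x, y⟩ ⟨hs, -⟩
    have hs' : |s| < β⁻¹ := abs_lt.2 hs
    have hB : ContDiffAt ℝ ∞ (fun q : ℝ × ℝ × ℝ => cosB β κ q.1 q.2.1) (s, x, y) :=
      (contDiffAt_cosB hκ hs' x).comp (s, x, y) (f := fun q : ℝ × ℝ × ℝ => (q.1, q.2.1))
        (by fun_prop)
    exact ((hM.contDiffAt.comp (s, x, y) (contDiffAt_fst.prodMk hB)).inv
      (cosM_pos hs' _).ne').contDiffWithinAt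
  exact key.congr fun q hq => cosField_coe hn (h q.1 (abs_lt.2 hq.1)) L q.2.1 q.2.2

theorem isMagneticFunction_cosField {n : ℕ} (hn : κ * β = n * (2 * Real.pi)) (hs : |s| < β⁻¹)
    (h : IsClosedProfile β (cosX β κ s) (cosM β κ s) (cosB β κ s) (cosH β κ s)) (L : ℝ) :
    IsMagneticFunction L (cosField L β κ s) := by
  have hM : ContDiff ℝ ∞ (cosM β κ s) := by
    unfold cosM
    fun_prop
  simp only [IsMagneticFunction, cosField_coe hn h]
  exact ((hM.comp h.contDiff_B).comp contDiff_fst).inv fun q => (cosM_pos hs _).ne'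

/-- A lower bound (in fact the value) of the maximum of the magnetic function. -/
theorem le_iSup_cosField {n : ℕ} (hκ : κ ≠ 0) (hn : κ * β = n * (2 * Real.pi))
    (hs : |s| < β⁻¹)
    (h : IsClosedProfile β (cosX β κ s) (cosM β κ s) (cosB β κ s) (cosH β κ s)) (L : ℝ) :
    (β⁻¹ - |s|)⁻¹ ≤ ⨆ p, cosField L β κ s p := by
  have hbdd : BddAbove (Set.range (cosField L β κ s)) :=
    ⟨_, by rintro _ ⟨p, rfl⟩; exact cosField_le hs L p⟩
  -- The field peaks where s cos(κu) = -|s|, so the choice of u depends on the sign of s.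
  obtain ⟨u, hu⟩ : ∃ u, cosM β κ s u = β⁻¹ - |s| := by
    rcases le_total 0 s with h0 | h0
    · refine ⟨Real.pi / κ, ?_⟩
      rw [cosM, mul_div_cancel₀ _ hκ, Real.cos_pi, abs_of_nonneg h0]
      ring
    · refine ⟨0, ?_⟩
      rw [cosM, mul_zero, Real.cos_zero, abs_of_nonpos h0]
      ring
  have := le_ciSup hbdd ((cosX β κ s u : AddCircle (1 : ℝ)), ((0 : ℝ) : AddCircle L))
  rwa [cosField_coe hn h, h.B_X, hu] at this

theorem tendsto_iSup_cosField {n : ℕ} (hκ : κ ≠ 0)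
    (hn : κ * β = n * (2 * Real.pi))
    (h : ∀ s, |s| < β⁻¹ →
      IsClosedProfile β (cosX β κ s) (cosM β κ s) (cosB β κ s) (cosH β κ s)) (L : ℝ)
    {l : Filter ℝ} {a : ℝ} (hl : l ≤ 𝓝 a) (ha : |a| = β⁻¹) (hls : ∀ᶠ s in l, |s| < β⁻¹) :
    Filter.Tendsto (fun s => ⨆ p, cosField L β κ s p) l Filter.atTop := by
  refine Filter.tendsto_atTop_mono' (f₁ := fun s => (β⁻¹ - |s|)⁻¹) l ?_ ?_
  · filter_upwards [hls] with s hs using le_iSup_cosField hκ hn hs (h s hs) L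
  · refine Filter.Tendsto.inv_tendsto_nhdsGT_zero (tendsto_nhdsWithin_iff.2 ⟨?_, ?_⟩)
    · have : Filter.Tendsto (fun s : ℝ => β⁻¹ - |s|) (𝓝 a) (𝓝 (β⁻¹ - |a|)) :=
        (continuous_const.sub continuous_abs).tendsto a
      rw [ha, sub_self] at this
      exact this.mono_left hl
    · filter_upwards [hls] with s hs using sub_pos.2 hs

theorem cosField_zero (L β κ : ℝ) (p : FlatTorus L) : cosField L β κ 0 p = β := by
  simp [cosField, cosM]

/-- Every `cosX β κ s` fixes 0, so at x = 0 the field is explicitly 1/(β⁻¹ + s) for small s. -/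
theorem deriv_cosField_zero_ne {n : ℕ} (hβ : 0 < β)
    (hn : κ * β = n * (2 * Real.pi))
    (h : ∀ s, |s| < β⁻¹ →
      IsClosedProfile β (cosX β κ s) (cosM β κ s) (cosB β κ s) (cosH β κ s)) (L : ℝ) :
    deriv (fun s => cosField L β κ s
      (((0 : ℝ) : AddCircle (1 : ℝ)), ((0 : ℝ) : AddCircle L))) 0 ≠ 0 := by
  have hev : (fun s => cosField L β κ s
      (((0 : ℝ) : AddCircle (1 : ℝ)), ((0 : ℝ) : AddCircle L))) =ᶠ[𝓝 0]
      fun s => (β⁻¹ + s)⁻¹ := by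
    have hlt : ∀ᶠ s : ℝ in 𝓝 0, |s| < β⁻¹ :=
      (continuous_abs.tendsto (0 : ℝ)).eventually_lt_const (by simpa using hβ)
    filter_upwards [hlt] with s hs
    have hX : cosX β κ s 0 = 0 := by simp [cosX]
    have hB : cosB β κ s 0 = 0 := by
      conv_lhs => rw [← hX]
      exact (h s hs).B_X 0
    rw [cosField_coe hn (h s hs), hB]
    simp [cosM]
  have hd : HasDerivAt (fun s => (β⁻¹ + s)⁻¹) (-1 / (β⁻¹ + 0) ^ 2) 0 :=
    ((hasDerivAt_id (0 : ℝ)).const_add β⁻¹).inv (by simp [hβ.ne'])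
  rw [hev.deriv_eq, hd.deriv]
  simp [hβ.ne']

theorem exists_zoll_family {L : ℝ} (hL : 0 < L) {β : ℝ} (hβ : β ∈ resonantSet) :
    ∃ b : ℝ → FlatTorus L → ℝ,
      (∀ s ∈ Set.Ioo (-β⁻¹) β⁻¹,
        IsMagneticFunction L (b s) ∧ (∀ p, 0 < b s p) ∧ DependsOnlyOnX L (b s) ∧
        average L (b s) = β ∧ IsZoll L (b s)) ∧
      ContDiffOn ℝ ∞
        (fun q : ℝ × ℝ × ℝ => b q.1 ((q.2.1 : AddCircle (1 : ℝ)), (q.2.2 : AddCircle L)))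
        (Set.Ioo (-β⁻¹) β⁻¹ ×ˢ Set.univ) ∧
      (∀ p, b 0 p = β) ∧
      (∃ p, deriv (fun s => b s p) 0 ≠ 0) ∧
      Filter.Tendsto (fun s => ⨆ p, b s p) (𝓝[<] β⁻¹) Filter.atTop ∧
      Filter.Tendsto (fun s => ⨆ p, b s p) (𝓝[>] (-β⁻¹)) Filter.atTop := by
  obtain ⟨n, κ, hn0, hκ, hJ, hβn⟩ := hβ
  have hβ0 : 0 < β := by
    rw [hβn]
    have : (0 : ℝ) < n := Nat.cast_pos.2 hn0
    positivity
  have hn : κ * β = n * (2 * Real.pi) := by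
    rw [hβn]
    field_simp
  have h : ∀ s, |s| < β⁻¹ →
      IsClosedProfile β (cosX β κ s) (cosM β κ s) (cosB β κ s) (cosH β κ s) := fun s hs =>
    isClosedProfile_cos hβ0 hκ.ne' hn hs (by rw [hJ, mul_zero])
  have hi : -β⁻¹ < β⁻¹ := neg_lt_self (inv_pos.2 hβ0)
  refine ⟨cosField L β κ, fun s hs => ?_, contDiffOn_cosField hκ.ne' hn h L,
    cosField_zero L β κ, ⟨_, deriv_cosField_zero_ne hβ0 hn h L⟩,
    tendsto_iSup_cosField hκ.ne' hn h L nhdsWithin_le_nhds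
      (abs_of_pos (inv_pos.2 hβ0)) ?_,
    tendsto_iSup_cosField hκ.ne' hn h L nhdsWithin_le_nhds
      (by rw [abs_neg, abs_of_pos (inv_pos.2 hβ0)]) ?_⟩
  · have hs' : |s| < β⁻¹ := abs_lt.2 hs
    exact ⟨isMagneticFunction_cosField hn hs' (h s hs') L, cosField_pos hs' L,
      cosField_dependsOnlyOnX L β κ s, average_cosField hn hL.ne' hκ.ne' hs' (h s hs'),
      (h s hs').isZoll (cosField_coe hn (h s hs') L)⟩
  · filter_upwards [Ioo_mem_nhdsLT hi] with s hs using abs_lt.2 hs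
  · filter_upwards [Ioo_mem_nhdsGT hi] with s hs using abs_lt.2 hs

theorem isZoll_const (L : ℝ) {β : ℝ} (hβ : 0 < β) : IsZoll L fun _ => β := by
  have hκ : 2 * Real.pi / β ≠ 0 := (div_pos Real.two_pi_pos hβ).ne'
  have hn : 2 * Real.pi / β * β = (1 : ℕ) * (2 * Real.pi) := by
    field_simp
    simp
  have h := isClosedProfile_cos (s := 0) hβ hκ hn (by simpa using hβ) (zero_mul _)
  exact h.isZoll fun x y => by simp [cosM]

/-! ### Rigidity: a Zoll field has no zero -/

/-- A countable subset of ℝ is totally disconnected. This serves for displacements in ℤL and in ℚL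
alike. -/
theorem exists_eq_of_continuous_of_countable_range {α : Type*} [TopologicalSpace α]
    [PreconnectedSpace α] [Nonempty α] {f : α → ℝ} (hf : Continuous f)
    (hc : (Set.range f).Countable) : ∃ v, ∀ a, f a = v := by
  have hs := hc.isTotallyDisconnected (Set.range f) subset_rfl (isPreconnected_range hf)
  obtain ⟨a⟩ := ‹Nonempty α›
  exact ⟨f a, fun b => hs ⟨b, rfl⟩ ⟨a, rfl⟩⟩

theorem countable_range_of_mem_zmultiples {α : Type*} {f : α → ℝ} {L : ℝ}
    (hf : ∀ a, ∃ j : ℤ, f a = j * L) : (Set.range f).Countable := by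
  refine (Set.countable_range fun j : ℤ => (j : ℝ) * L).mono ?_
  rintro _ ⟨a, rfl⟩
  obtain ⟨j, hj⟩ := hf a
  exact ⟨j, hj.symm⟩

/-- The pair (x, θ) starts at an equilibrium of its own closed system, so ODE uniqueness keeps it
there. -/
theorem IsLiftedSolution.eq_vertical {β x y θ : ℝ → ℝ} (h : IsLiftedSolution β x y θ)
    {K : NNReal} (hβ : LipschitzWith K β) (h0 : β (x 0) = 0) (hc : Real.cos (θ 0) = 0) :
    (∀ t, x t = x 0) ∧ (∀ t, θ t = θ 0) ∧ ∀ t, y t = y 0 + Real.sin (θ 0) * t := by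
  have hv : LipschitzWith (max 1 K) fun p : ℝ × ℝ => (Real.cos p.2, β p.1) := by
    have := (Real.lipschitzWith_cos.comp LipschitzWith.prod_snd).prodMk
      (hβ.comp (LipschitzWith.prod_fst (α := ℝ) (β := ℝ)))
    simpa using this
  have hu := ODE_solution_unique_univ (v := fun _ (p : ℝ × ℝ) => (Real.cos p.2, β p.1))
    (s := fun _ => Set.univ) (t₀ := 0) (f := fun t => (x t, θ t)) (g := fun _ => (x 0, θ 0))
    (fun _ => hv.lipschitzOnWith) (fun t => ⟨(h.hx t).prodMk (h.hθ t), trivial⟩)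
    (fun t => ⟨(hasDerivAt_const t (x 0, θ 0)).congr_deriv (by simp only [h0, hc]; rfl), trivial⟩) rfl
  have hθ : ∀ t, θ t = θ 0 := fun t => congrArg Prod.snd (congrFun hu t)
  refine ⟨fun t => congrArg Prod.fst (congrFun hu t), hθ, fun t => ?_⟩
  have hd : ∀ t, HasDerivAt (fun t => y t - Real.sin (θ 0) * t) 0 t := fun t =>
    ((h.hy t).sub ((hasDerivAt_id t).const_mul _)).congr_deriv (by simp [hθ t])
  have := is_const_of_deriv_eq_zero (fun t => (hd t).differentiableAt) (fun t => (hd t).deriv) t 0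
  simp only [mul_zero, sub_zero] at this
  linarith

/-- A magnetic function with a zero is not Zoll: the two vertical orbits over the zero have
opposite homotopy classes. -/
theorem ne_zero_of_isZoll {L : ℝ} {b : FlatTorus L → ℝ} {β : ℝ → ℝ} {K : NNReal}
    (hβ : LipschitzWith K β)
    (hb : ∀ x y : ℝ, b ((x : AddCircle (1 : ℝ)), (y : AddCircle L)) = β x) (hZ : IsZoll L b)
    (x₀ : ℝ) : β x₀ ≠ 0 := by
  intro h0
  obtain ⟨Φ, A, hΦ, hA, hτ⟩ := hZ
  obtain ⟨G, hG, hGA⟩ := hA.smooth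
  have hGc := hG.continuous
  -- v is the y-displacement of the lifted action over one period: it lies in ℤL and is continuous
  -- in the orbit, hence common to all orbits.
  obtain ⟨v, hv⟩ := exists_eq_of_continuous_of_countable_range
    (f := fun p : ℝ × ℝ × ℝ => (G (1, p)).2.1 - (G (0, p)).2.1) (by fun_prop)
    (countable_range_of_mem_zmultiples (L := L) fun p => by
      have h : unitProj L (G (0, p)) = unitProj L (G (1, p)) := by
        rw [hGA, hGA]
        congr 1
        exact addCircle_coe_eq_iff.2 ⟨1, by simp⟩
      obtain ⟨i, j, k, hj⟩ := unitProj_eq_iff.1 h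
      exact ⟨j, by rw [hj]; ring⟩)
  have key : ∀ θ₀ : ℝ, Real.cos θ₀ = 0 → ∃ T > 0, v = Real.sin θ₀ * T := by
    intro θ₀ hc
    obtain ⟨hΦ0, hgeo⟩ := hΦ (unitProj L (x₀, 0, θ₀))
    obtain ⟨x, y, θ, hsol, hx, hy, hθ, hp⟩ := hgeo.exists_solution hβ.continuous hb hΦ0
    obtain ⟨-, -, hyt⟩ := hsol.eq_vertical hβ (by rw [hx, h0]) (by rw [hθ, hc])
    simp only [hθ, hy, zero_add] at hyt
    obtain ⟨τ, hτ⟩ := hτ (unitProj L (x₀, 0, θ₀))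
    have hτc := τ.continuous
    -- The lift `G` and the vertical orbit differ in y by a constant element of ℤL, so v is the
    -- orbit's signed length; going up and going down give opposite signs.
    obtain ⟨w, hw⟩ := exists_eq_of_continuous_of_countable_range
      (f := fun t : ℝ => (G (t, (x₀, 0, θ₀))).2.1 - Real.sin θ₀ * τ t) (by fun_prop)
      (countable_range_of_mem_zmultiples (L := L) fun t => by
        have h := hGA t (x₀, 0, θ₀)
        rw [hτ, hp] at h
        obtain ⟨i, j, k, hj⟩ := unitProj_eq_iff.1 h.symm
        exact ⟨j, by rw [hj]; simp [hyt]⟩)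
    refine ⟨τ 1 - τ 0, sub_pos.2 (τ.strictMono one_pos), ?_⟩
    rw [← hv (x₀, 0, θ₀)]
    linear_combination hw 1 - hw 0
  obtain ⟨T, hT, h1⟩ := key (Real.pi / 2) Real.cos_pi_div_two
  obtain ⟨T', hT', h2⟩ := key (-(Real.pi / 2)) (by rw [Real.cos_neg, Real.cos_pi_div_two])
  rw [Real.sin_neg, Real.sin_pi_div_two] at h2
  rw [Real.sin_pi_div_two] at h1
  linarith

/-! ### Fourier analysis of the displacement -/

theorem besselJ1_neg (κ : ℝ) : besselJ1 (-κ) = -besselJ1 κ := by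
  simp only [besselJ1, neg_mul, Real.cos_neg, neg_div]

theorem besselJ1_ne_zero {β : ℝ} (hβ : 0 < β) (hres : β ∉ resonantSet) {n : ℤ} (hn : n ≠ 0) :
    besselJ1 (2 * Real.pi * n / β) ≠ 0 := by
  have hpos : ∀ m : ℕ, 0 < m → besselJ1 (2 * Real.pi * m / β) ≠ 0 := fun m hm hJ => by
    have hm' : (0 : ℝ) < m := Nat.cast_pos.2 hm
    refine hres ⟨m, 2 * Real.pi * m / β, hm, by positivity, hJ, ?_⟩
    have := Real.pi_pos.ne'
    field_simp
  obtain ⟨m, rfl | rfl⟩ := n.eq_nat_or_neg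
  · exact_mod_cast hpos m (by omega)
  · push_cast
    rw [mul_neg, neg_div, besselJ1_neg]
    exact neg_ne_zero.2 (hpos m (by omega))

theorem integral_sin_mul_cexp (κ : ℝ) :
    ∫ θ in (0 : ℝ)..(2 * Real.pi),
      (Real.sin θ : ℂ) * Complex.exp ((κ * Real.sin θ : ℝ) * Complex.I) =
      (2 * Real.pi * besselJ1 κ : ℝ) * Complex.I := by
  have h : ∀ θ : ℝ, (Real.sin θ : ℂ) * Complex.exp ((κ * Real.sin θ : ℝ) * Complex.I) =
      ((Real.sin θ * Real.cos (κ * Real.sin θ) : ℝ) : ℂ) +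
        ((Real.sin θ * Real.sin (κ * Real.sin θ) : ℝ) : ℂ) * Complex.I := fun θ => by
    rw [Complex.exp_mul_I, ← Complex.ofReal_cos, ← Complex.ofReal_sin]
    push_cast
    ring
  simp only [h]
  rw [intervalIntegral.integral_add (Continuous.intervalIntegrable (by fun_prop) _ _)
    (Continuous.intervalIntegrable (by fun_prop) _ _), intervalIntegral.integral_mul_const,
    intervalIntegral.integral_ofReal, intervalIntegral.integral_ofReal, integral_sin_mul_cos,
    integral_sin_mul_sin]
  simp

/-- With one possibly nonzero coefficient the Fourier series is trivially summable, so it converges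
uniformly to the function. -/
theorem exists_eq_of_integral_cexp_eq_zero {T : ℝ} (hT : 0 < T) {f : ℝ → ℝ} (hf : Continuous f)
    (hp : Function.Periodic f T)
    (h : ∀ n : ℤ, n ≠ 0 →
      ∫ u in (0 : ℝ)..T, (f u : ℂ) * Complex.exp ((-(2 * Real.pi * n / T * u) : ℝ) * Complex.I) = 0) :
    ∃ v, ∀ u, f u = v := by
  have : Fact (0 < T) := ⟨hT⟩
  have hp' : Function.Periodic (fun u => (f u : ℂ)) T := fun u => by simp only [hp u]
  set F : C(AddCircle T, ℂ) := ⟨hp'.lift, by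
    refine continuous_quot_lift _ ?_
    exact Complex.continuous_ofReal.comp hf⟩ with hF
  have hFu : ∀ u : ℝ, F (u : AddCircle T) = f u := fun u => rfl
  have hcoef : ∀ n : ℤ, n ≠ 0 → fourierCoeff F n = 0 := fun n hn => by
    rw [fourierCoeff_eq_intervalIntegral F n 0, zero_add]
    refine smul_eq_zero_of_right _ (Eq.trans ?_ (h n hn))
    refine intervalIntegral.integral_congr fun u _ => ?_
    simp only [hFu, fourier_coe_apply, smul_eq_mul]
    rw [mul_comm]
    congr 2
    push_cast
    ring
  have hsum := hasSum_fourier_series_of_summable (f := F)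
    (summable_of_ne_finset_zero (s := {0}) fun n hn => hcoef n (by simpa using hn))
  have h0 : F = fourierCoeff F 0 • fourier 0 :=
    hsum.unique (hasSum_single 0 fun n hn => by rw [hcoef n hn, zero_smul])
  refine ⟨(fourierCoeff F 0).re, fun u => ?_⟩
  have := congrArg (fun g : C(AddCircle T, ℂ) => (g (u : AddCircle T)).re) h0
  simpa [hFu] using this

/-- A periodic profile all of whose vertical displacements agree is constant away from the
resonant set. -/
theorem exists_eq_of_displacement_const {β : ℝ} (hβ : 0 < β) (hres : β ∉ resonantSet)
    {m : ℝ → ℝ} (hm : Continuous m) (hp : Function.Periodic m β) {D : ℝ}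
    (hD : ∀ c, ∫ θ in (0 : ℝ)..(2 * Real.pi), Real.sin θ * m (c + Real.sin θ) = D) :
    ∃ v, ∀ u, m u = v := by
  refine exists_eq_of_integral_cexp_eq_zero hβ hm hp fun n hn => ?_
  set κ := 2 * Real.pi * n / β with hκ
  set e : ℝ → ℂ := fun u => Complex.exp ((-(κ * u) : ℝ) * Complex.I) with he
  have hec : Continuous e := by fun_prop
  have hep : Function.Periodic e β := fun u => by
    simp only [he]
    rw [Complex.exp_eq_exp_iff_exists_int]
    refine ⟨-n, ?_⟩
    have : (β : ℂ) ≠ 0 := Complex.ofReal_ne_zero.2 hβ.ne'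
    rw [hκ]
    push_cast
    field_simp
    ring
  have he0 : ∫ u in (0 : ℝ)..β, e u = 0 := by
    have hκ0 : κ ≠ 0 := div_ne_zero
      (mul_ne_zero Real.two_pi_pos.ne' (Int.cast_ne_zero.2 hn)) hβ.ne'
    have hc0 : ((-κ : ℝ) : ℂ) * Complex.I ≠ 0 :=
      mul_ne_zero (Complex.ofReal_ne_zero.2 (neg_ne_zero.2 hκ0)) Complex.I_ne_zero
    have hfun : e = fun u : ℝ => Complex.exp (((-κ : ℝ) : ℂ) * Complex.I * u) := by
      funext u
      simp only [he]
      congr 1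
      push_cast
      ring
    have h1 := hep 0
    simp only [zero_add, hfun] at h1
    rw [hfun, integral_exp_mul_complex hc0, h1, sub_self, zero_div]
  set I := ∫ u in (0 : ℝ)..β, (m u : ℂ) * e u with hI
  -- Translating m by sin θ multiplies its Fourier coefficient by a phase.
  have hshift : ∀ θ : ℝ, ∫ c in (0 : ℝ)..β, ((Real.sin θ * m (c + Real.sin θ) : ℝ) : ℂ) * e c =
      (Real.sin θ : ℂ) * Complex.exp ((κ * Real.sin θ : ℝ) * Complex.I) * I := fun θ => by
    have h1 : ∀ c, ((Real.sin θ * m (c + Real.sin θ) : ℝ) : ℂ) * e c =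
        (Real.sin θ : ℂ) * Complex.exp ((κ * Real.sin θ : ℝ) * Complex.I) *
          ((m (c + Real.sin θ) : ℂ) * e (c + Real.sin θ)) := fun c => by
      have : e c = Complex.exp ((κ * Real.sin θ : ℝ) * Complex.I) * e (c + Real.sin θ) := by
        simp only [he]
        rw [← Complex.exp_add]
        congr 1
        push_cast
        ring
      rw [this]
      push_cast
      ring
    have hper : Function.Periodic (fun u => (m u : ℂ) * e u) β := fun u => by
      simp only [hp u, hep u]
    simp only [h1]
    rw [intervalIntegral.integral_const_mul,
      intervalIntegral.integral_comp_add_right (fun u => (m u : ℂ) * e u), zero_add, add_comm β,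
      hper.intervalIntegral_add_eq _ 0, zero_add]
  -- One order gives D · ∫ e = 0, the other 2πi J₁(κ) · I.
  have hswap : ∫ c in (0 : ℝ)..β, ∫ θ in (0 : ℝ)..(2 * Real.pi),
        ((Real.sin θ * m (c + Real.sin θ) : ℝ) : ℂ) * e c =
      ∫ θ in (0 : ℝ)..(2 * Real.pi), ∫ c in (0 : ℝ)..β,
        ((Real.sin θ * m (c + Real.sin θ) : ℝ) : ℂ) * e c := by
    refine MeasureTheory.intervalIntegral_intervalIntegral_swap ?_
    refine MeasureTheory.IntegrableOn.mono_set (t := Set.uIcc 0 β ×ˢ Set.uIcc 0 (2 * Real.pi)) ?_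
      (Set.prod_mono Set.uIoc_subset_uIcc Set.uIoc_subset_uIcc)
    refine ContinuousOn.integrableOn_compact (isCompact_uIcc.prod isCompact_uIcc)
      (Continuous.continuousOn ?_)
    unfold Function.uncurry
    fun_prop
  simp only [hshift, intervalIntegral.integral_mul_const, integral_sin_mul_cexp,
    intervalIntegral.integral_ofReal, hD, intervalIntegral.integral_const_mul, he0,
    mul_zero] at hswap
  refine (mul_eq_zero.1 hswap.symm).resolve_left (mul_ne_zero (Complex.ofReal_ne_zero.2 ?_)
    Complex.I_ne_zero)
  exact mul_ne_zero Real.two_pi_pos.ne' (besselJ1_ne_zero hβ hres hn)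

/-! ### From closed orbits to constant fields -/

/-- Along closed orbits the vertical displacement over one turn is a rational multiple of `L`. -/
theorem exists_displacement_eq {L : ℝ} {b : FlatTorus L → ℝ} {β B X : ℝ → ℝ}
    (hβ : Continuous β) (hpos : ∀ x, 0 < β x)
    (hb : ∀ x y : ℝ, b ((x : AddCircle (1 : ℝ)), (y : AddCircle L)) = β x)
    (hB : ∀ x, HasDerivAt B (β x) x) (hXB : ∀ x, X (B x) = x) (hBX : ∀ u, B (X u) = u)
    (hm : Continuous fun u => (β (X u))⁻¹) (hZ : IsZoll L b) (c : ℝ) :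
    ∃ q : ℚ, ∫ θ in (0 : ℝ)..(2 * Real.pi), Real.sin θ * (β (X (c + Real.sin θ)))⁻¹ = q * L := by
  obtain ⟨Φ, A, hΦ, hA, hτ⟩ := hZ
  set z := unitProj L (X c, 0, 0) with hz
  obtain ⟨hΦ0, hgeo⟩ := hΦ z
  obtain ⟨x, y, θ, hsol, hx, hy, hθ, hp⟩ := hgeo.exists_solution hβ hb hΦ0
  obtain ⟨τ, hτ⟩ := hτ z
  have hlt : τ 0 < τ 1 := τ.strictMono one_pos
  have hclosed : unitProj L (x (τ 0), y (τ 0), θ (τ 0)) =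
      unitProj L (x (τ 1), y (τ 1), θ (τ 1)) := by
    rw [← hp, ← hp, ← hτ, ← hτ]
    congr 1
    exact addCircle_coe_eq_iff.2 ⟨1, by simp⟩
  obtain ⟨i, j, k, hijk⟩ := unitProj_eq_iff.1 hclosed
  simp only [Prod.mk.injEq] at hijk
  obtain ⟨-, hyj, hθk⟩ := hijk
  have hk : k ≠ 0 := by
    rintro rfl
    have := strictMono_of_hasDerivAt_pos hsol.hθ (fun t => hpos _) hlt
    simp only [Int.cast_zero, zero_mul, add_zero] at hθk
    exact this.ne' hθk
  -- B(x) - sin θ is conserved, and equals c because the orbit starts at X c with angle 0.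
  have hcons : ∀ t, x t = X (c + Real.sin (θ t)) := by
    have hd : ∀ t, HasDerivAt (fun t => B (x t) - Real.sin (θ t)) 0 t := fun t =>
      (((hB _).comp t (hsol.hx t)).sub (hsol.hθ t).sin).congr_deriv (by ring)
    intro t
    have := is_const_of_deriv_eq_zero (fun t => (hd t).differentiableAt)
      (fun t => (hd t).deriv) t 0
    rw [hx, hθ, hBX, Real.sin_zero, sub_zero] at this
    rw [← hXB (x t)]
    congr 1
    linarith
  set f : ℝ → ℝ := fun φ => Real.sin φ * (β (X (c + Real.sin φ)))⁻¹ with hf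
  have hfc : Continuous f :=
    Real.continuous_sin.mul (hm.comp (continuous_const.add Real.continuous_sin))
  have hfp : Function.Periodic f (2 * Real.pi) := fun φ => by
    simp only [hf, Real.sin_add_two_pi]
  have hyf : ∀ t, HasDerivAt (fun t => y t - ∫ φ in θ (τ 0)..θ t, f φ) 0 t := fun t => by
    have h1 : HasDerivAt (fun r => ∫ φ in θ (τ 0)..r, f φ) (f (θ t)) (θ t) :=
      intervalIntegral.integral_hasDerivAt_right (hfc.intervalIntegrable _ _)
        (hfc.stronglyMeasurableAtFilter _ _) hfc.continuousAt
    refine ((hsol.hy t).sub (h1.comp t (hsol.hθ t))).congr_deriv ?_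
    have := (hpos (x t)).ne'
    simp only [hf, ← hcons]
    field_simp
    ring
  have h2 := is_const_of_deriv_eq_zero (fun t => (hyf t).differentiableAt)
    (fun t => (hyf t).deriv) (τ 1) (τ 0)
  simp only [intervalIntegral.integral_same, sub_zero] at h2
  have h3 := hfp.intervalIntegral_add_zsmul_eq k (θ (τ 0)) fun _ _ => hfc.intervalIntegrable _ _
  rw [hfp.intervalIntegral_add_eq _ 0, zero_add, zsmul_eq_mul, ← hθk, zsmul_eq_mul] at h3
  -- The orbit closes after k turns, each moving y by the same integral, with total jL. Nothing here
  -- forces k = 1, hence only rationality.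
  refine ⟨j / k, ?_⟩
  have hk' : (k : ℝ) ≠ 0 := Int.cast_ne_zero.2 hk
  push_cast
  field_simp
  linarith

theorem eq_const_of_isZoll {L : ℝ} (hL : 0 < L) {bcon : ℝ} (h0 : 0 ≤ bcon)
    (hres : bcon ∉ resonantSet) {b : FlatTorus L → ℝ} (hbs : IsMagneticFunction L b)
    (hbx : DependsOnlyOnX L b) (hav : average L b = bcon) (hZ : IsZoll L b) (p : FlatTorus L) :
    b p = bcon := by
  set β : ℝ → ℝ := fun x => b ((x : AddCircle (1 : ℝ)), ((0 : ℝ) : AddCircle L)) with hβdef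
  have hb : ∀ x y : ℝ, b ((x : AddCircle (1 : ℝ)), (y : AddCircle L)) = β x :=
    fun x y => hbx _ _ _
  have hβs : ContDiff ℝ ∞ β := by
    unfold IsMagneticFunction at hbs
    exact hbs.comp (contDiff_prodMk_left (0 : ℝ))
  have hβ := hβs.continuous
  have hper : Function.Periodic β 1 := fun x => by
    simp only [hβdef]
    congr 2
    exact (addCircle_coe_eq_iff.2 ⟨1, by simp⟩).symm
  have hmean : ∫ x in (0 : ℝ)..1, β x = bcon := by
    rw [← hav]
    simp only [average, hb, intervalIntegral.integral_const, sub_zero, smul_eq_mul,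
      intervalIntegral.integral_const_mul]
    field_simp
  have hper' : Function.Periodic (deriv β) 1 := fun x => by
    rw [← deriv_comp_add_const, show (fun x => β (x + 1)) = β from funext hper]
  obtain ⟨C, hC⟩ := (hper'.isBounded_of_continuous one_ne_zero
    (hβs.continuous_deriv (by simp))).exists_norm_le
  have hlip : LipschitzWith C.toNNReal β :=
    lipschitzWith_of_nnnorm_deriv_le (hβs.differentiable (by simp)) fun x =>
      NNReal.le_toNNReal_of_coe_le (hC _ ⟨x, rfl⟩)
  have hne := ne_zero_of_isZoll hlip hb hZ
  have hpos : ∀ x, 0 < β x := by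
    by_contra! hcon
    obtain ⟨x₁, hx₁⟩ := hcon
    have hneg : ∀ x, β x < 0 := fun x => by
      by_contra! hx
      obtain ⟨t, ht⟩ := mem_range_of_exists_le_of_exists_ge hβ ⟨x₁, hx₁⟩ ⟨x, hx⟩
      exact hne t ht
    have : 0 < ∫ x in (0 : ℝ)..1, -β x :=
      intervalIntegral.intervalIntegral_pos_of_pos (hβ.neg.intervalIntegrable _ _)
        (fun x => neg_pos.2 (hneg x)) one_pos
    rw [intervalIntegral.integral_neg, hmean] at this
    linarith
  -- This excludes `bcon = 0`: no Zoll field depending only on x has zero average.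
  have hbcon : 0 < bcon := by
    rw [← hmean]
    exact intervalIntegral.intervalIntegral_pos_of_pos (hβ.intervalIntegrable _ _) hpos one_pos
  obtain ⟨δ, hδ, hδβ⟩ : ∃ δ > 0, ∀ x, δ ≤ β x := by
    obtain ⟨_, ⟨x₁, rfl⟩, h₁⟩ := (hper.compact_of_continuous one_ne_zero hβ).exists_isLeast
      (Set.range_nonempty β)
    exact ⟨β x₁, hpos x₁, fun x => h₁ ⟨x, rfl⟩⟩
  set B : ℝ → ℝ := fun x => ∫ t in (0 : ℝ)..x, β t with hBdef
  have hB : ∀ x, HasDerivAt B (β x) x := fun x =>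
    intervalIntegral.integral_hasDerivAt_right (hβ.intervalIntegrable _ _)
      (hβ.stronglyMeasurableAtFilter _ _) hβ.continuousAt
  have hBadd : ∀ x, B (x + 1) = B x + bcon := fun x => by
    rw [← hmean]
    simpa using hper.intervalIntegral_add_eq_add 0 x fun _ _ => hβ.intervalIntegrable _ _
  set e : ℝ ≃o ℝ := (strictMono_of_hasDerivAt_pos hB hpos).orderIsoOfSurjective B
    (surjective_of_hasDerivAt_ge hδ hB hδβ) with he
  have hXB : ∀ x, e.symm (B x) = x := e.symm_apply_apply
  have hBX : ∀ u, B (e.symm u) = u := e.apply_symm_apply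
  have hm : Continuous fun u => (β (e.symm u))⁻¹ :=
    (hβ.comp e.symm.continuous).inv₀ fun u => (hpos _).ne'
  have hmp : Function.Periodic (fun u => (β (e.symm u))⁻¹) bcon := fun u => by
    have : e.symm (u + bcon) = e.symm u + 1 := by
      rw [← hXB (e.symm u + 1), hBadd, hBX]
    simp only [this, hper _]
  -- The displacement is continuous in c with values in the countable set ℚL.
  obtain ⟨D, hD⟩ := exists_eq_of_continuous_of_countable_range
    (f := fun c : ℝ => ∫ θ in (0 : ℝ)..(2 * Real.pi),
      Real.sin θ * (β (e.symm (c + Real.sin θ)))⁻¹)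
    (intervalIntegral.continuous_parametric_intervalIntegral_of_continuous' (by
      have := hm.comp (continuous_fst.add (Real.continuous_sin.comp (continuous_snd (X := ℝ))))
      exact (Real.continuous_sin.comp continuous_snd).mul this) _ _)
    ((Set.countable_range fun q : ℚ => (q : ℝ) * L).mono (by
      rintro _ ⟨c, rfl⟩
      obtain ⟨q, hq⟩ := exists_displacement_eq hβ hpos hb hB hXB hBX hm hZ c
      exact ⟨q, hq.symm⟩))
  obtain ⟨v, hv⟩ := exists_eq_of_displacement_const hbcon hres hm hmp hD
  have hconst : ∀ x, β x = v⁻¹ := fun x => by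
    rw [← hv (B x), hXB, inv_inv]
  have hvb : v⁻¹ = bcon := by
    rw [← hmean]
    simp [hconst]
  obtain ⟨x, y⟩ := p
  obtain ⟨x, rfl⟩ := QuotientAddGroup.mk_surjective x
  exact (hbx _ y _).trans ((hconst x).trans hvb)

end MagneticTorus

theorem theorem2p1 (L : ℝ) (hL : 0 < L) (bcon : ℝ) :
    (bcon ∈ MagneticTorus.resonantSet →
      ∃ b : ℝ → MagneticTorus.FlatTorus L → ℝ,
        (∀ s ∈ Set.Ioo (-bcon⁻¹) bcon⁻¹,
          MagneticTorus.IsMagneticFunction L (b s) ∧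
          (∀ p, 0 < b s p) ∧
          MagneticTorus.DependsOnlyOnX L (b s) ∧
          MagneticTorus.average L (b s) = bcon ∧
          MagneticTorus.IsZoll L (b s)) ∧
        ContDiffOn ℝ ∞
          (fun q : ℝ × ℝ × ℝ => b q.1 ((q.2.1 : AddCircle (1 : ℝ)), (q.2.2 : AddCircle L)))
          (Set.Ioo (-bcon⁻¹) bcon⁻¹ ×ˢ Set.univ) ∧
        (∀ p, b 0 p = bcon) ∧
        (∃ p, deriv (fun s => b s p) 0 ≠ 0) ∧
        Filter.Tendsto (fun s => ⨆ p, b s p) (𝓝[<] bcon⁻¹) Filter.atTop ∧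
        Filter.Tendsto (fun s => ⨆ p, b s p) (𝓝[>] (-bcon⁻¹)) Filter.atTop) ∧
    (0 ≤ bcon → bcon ∉ MagneticTorus.resonantSet →
      (∀ b : MagneticTorus.FlatTorus L → ℝ,
        MagneticTorus.IsMagneticFunction L b →
        MagneticTorus.DependsOnlyOnX L b →
        MagneticTorus.average L b = bcon →
        MagneticTorus.IsZoll L b →
        ∀ p, b p = bcon) ∧
      (0 < bcon → MagneticTorus.IsZoll L (fun _ => bcon))) := by
  exact ⟨MagneticTorus.exists_zoll_family hL, fun h0 hres =>
    ⟨fun b hbs hbx hav hZ => MagneticTorus.eq_const_of_isZoll hL h0 hres hbs hbx hav hZ,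
      MagneticTorus.isZoll_const L⟩⟩
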